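/- Let $\overline{\mathbb Q}\subset\mathbb C$ be the field of algebraic numbers, let $\Gamma\subset\overline{\mathbb Q}^*$ be a finitely generated subgroup, and let $N\ge 1$ be an integer. Put $$\Gamma_{\mathrm{div}}=\{\gamma\in\overline{\mathbb Q}^* : \gamma^n\in\Gamma \text{ for some integer } n\ge 1\},\qquad K_\Gamma=\mathbb Q(\mu_\infty,\Gamma),$$ where $\mu_\infty$ is the set of all roots of unity. The length of $x\in\mathbb Q(\Gamma_{\mathrm{div}})$ is the smallest integer $l\ge 1$ such that $x=\sum_{j=1}^l x_j\gamma_j$ with $x_j\in K_\Gamma$ and $\gamma_j\in\Gamma_{\mathrm{div}}$; let $l_N(\Gamma)$ be the set of $x\in\mathbb Q(\Gamma_{\mathrm{div}})$ of length at most $N$. Let $U(\Gamma)$ be the set of $x\in\overline{\mathbb Q}^*$ such that all conjugates of $x$ over $K_\Gamma$, i.e. all $\sigma x$ with $\sigma\in\mathrm{Gal}(\overline{\mathbb Q}/K_\Gamma)$, lie on one circle of $\mathbb C$ centered at the origin. Then there is an integer $m\ge 1$, depending only on $\Gamma$ and $N$, with the following property. Let $\mathcal F=\{\alpha_1,\dots,\alpha_b\}\subset\Gamma$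 be a generating set of the torsion-free part of $\Gamma$, that is, $\alpha_1,\dots,\alpha_b$ are multiplicatively independent and every element of $\Gamma$ is a root of unity times an element of $\langle\alpha_1,\dots,\alpha_b\rangle$; and let $\mathcal F^{1/m}=\{\alpha_1^{1/m},\dots,\alpha_b^{1/m}\}$ for an arbitrary choice of the $m$-th roots. Then $$l_N(\Gamma)\cap U(\Gamma)\subset K_\Gamma(\mathcal F^{1/m})^*\cdot\Gamma_{\mathrm{div}},$$ i.e. every $x\in l_N(\Gamma)\cap U(\Gamma)$ is of the form $x=y\gamma$ with $0\ne y\in K_\Gamma(\mathcal F^{1/m})$ and $\gamma\in\Gamma_{\mathrm{div}}$. -/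

import Mathlib

/-- The field of algebraic numbers, as a subfield of `ℂ` (so that moduli make sense). -/
abbrev Qbar : Type := ↥(algebraicClosure ℚ ℂ)

namespace GammaDiv

/-- The division group `Γ_div`: all `γ` in `Qbarˣ` with `γ ^ n ∈ Γ` for some `n ≥ 1`. -/
def divGroup (Γ : Subgroup Qbarˣ) : Subgroup Qbarˣ where
  carrier := {γ | ∃ n : ℕ, 0 < n ∧ γ ^ n ∈ Γ}
  one_mem' := ⟨1, one_pos, by simp⟩
  mul_mem' := by
    rintro x y ⟨n, hn, hx⟩ ⟨k, hk, hy⟩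
    refine ⟨n * k, Nat.mul_pos hn hk, ?_⟩
    rw [mul_pow, pow_mul, mul_comm n k, pow_mul]
    exact Γ.mul_mem (Γ.pow_mem hx k) (Γ.pow_mem hy n)
  inv_mem' := by
    rintro x ⟨n, hn, hx⟩
    exact ⟨n, hn, by rw [inv_pow]; exact Γ.inv_mem hx⟩

/-- The field `K_Γ = ℚ(μ_∞, Γ)`. -/
noncomputable def baseField (Γ : Subgroup Qbarˣ) : IntermediateField ℚ Qbar :=
  IntermediateField.adjoin ℚ
    ({ζ : Qbar | ∃ n : ℕ, 0 < n ∧ ζ ^ n = 1} ∪ {x : Qbar | ∃ γ ∈ Γ, x = (γ : Qbar)})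

/-- The field `ℚ(Γ_div)`. -/
noncomputable def divField (Γ : Subgroup Qbarˣ) : IntermediateField ℚ Qbar :=
  IntermediateField.adjoin ℚ {x : Qbar | ∃ γ ∈ divGroup Γ, x = (γ : Qbar)}

/-- `x = ∑_{j=1}^l x_j γ_j` for some `x_j ∈ K_Γ` and `γ_j ∈ Γ_div`. -/
def IsSumOfLength (Γ : Subgroup Qbarˣ) (l : ℕ) (x : Qbar) : Prop :=
  ∃ (a : Fin l → Qbar) (γ : Fin l → Qbarˣ),
    (∀ j, a j ∈ baseField Γ) ∧ (∀ j, γ j ∈ divGroup Γ) ∧ x = ∑ j, a j * (γ j : Qbar)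

/-- The length of `x`: the smallest `l ≥ 1` such that `x` is a sum of `l` terms as above
(`⊤` if there is no such `l`, which does not happen on `ℚ(Γ_div)`). -/
noncomputable def length (Γ : Subgroup Qbarˣ) (x : Qbar) : ℕ∞ :=
  ⨅ (l : ℕ) (_ : 1 ≤ l ∧ IsSumOfLength Γ l x), (l : ℕ∞)

/-- `l_N(Γ)`: the elements of `ℚ(Γ_div)` of length at most `N`. -/
def boundedLength (Γ : Subgroup Qbarˣ) (N : ℕ) : Set Qbar :=
  {x | x ∈ divField Γ ∧ length Γ x ≤ (N : ℕ∞)}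

/-- `O_Γ(x)`: the orbit of `x` under `Gal(Qbar / K_Γ)`. -/
def galoisOrbit (Γ : Subgroup Qbarˣ) (x : Qbar) : Set Qbar :=
  {y | ∃ σ : Qbar ≃ₐ[baseField Γ] Qbar, y = σ x}

/-- `U(Γ)`: the nonzero algebraic numbers all of whose conjugates over `K_Γ` lie on one circle
centered at the origin. -/
def concyclicSet (Γ : Subgroup Qbarˣ) : Set Qbar :=
  {x | x ≠ 0 ∧ ∃ r : ℝ, ∀ y ∈ galoisOrbit Γ x, ‖(y : ℂ)‖ = r}

/-- `α_1, …, α_b` is a free generating family of the torsion-free part of `Γ`: the `α_i` lie in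
`Γ`, are multiplicatively independent, and generate `Γ` modulo roots of unity. -/
structure IsTorsionFreeBasis (Γ : Subgroup Qbarˣ) {b : ℕ} (α : Fin b → Qbarˣ) : Prop where
  mem : ∀ i, α i ∈ Γ
  indep : ∀ k : Fin b → ℤ, ∏ i, α i ^ k i = 1 → k = 0
  generate : ∀ γ ∈ Γ, ∃ (ζ : Qbarˣ) (k : Fin b → ℤ),
    (∃ n : ℕ, 0 < n ∧ ζ ^ n = 1) ∧ γ = ζ * ∏ i, α i ^ k i

/-- `X.Γ_div`: all products `x γ` with `x ∈ X` and `γ ∈ Γ_div`. -/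
def mulDiv (Γ : Subgroup Qbarˣ) (X : Set Qbar) : Set Qbar :=
  {z | ∃ x ∈ X, ∃ γ ∈ divGroup Γ, z = x * (γ : Qbar)}

end GammaDiv

/-!
Let `L ⊇ K_Γ` be an intermediate field and `x = ∑ x_γ γ` with `x_γ ∈ L` nonzero and finitely many
`γ ∈ Γ_div`. For `σ ∈ Gal(Qbar / L)` the quotient `σ γ / γ` is a root of unity, hence lies in `L`,
so `χ_γ : σ ↦ σ γ / γ` is a unitary character (`kummerChar`) and
`|σ x|² = ∑ x_γ γ conj(x_δ δ) (χ_γ / χ_δ)(σ)`. If `x ∈ U(Γ)`, this is constant in `σ`. By linear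
independence of characters, no nontrivial quotient `χ_γ / χ_δ` can be represented by a single pair
`(γ, δ)` (`mul_conj_eq_zero_of_norm_sum_const`).

On the other hand, `n ≥ 2` elements of an abelian group always have a quotient represented only
once, unless two of them become equal after raising to the power `M`, where `M` depends on `n`
only (`exists_unique_div`). Hence two of the `γ` have a quotient whose `M`-th power lies in `L`
(`exists_div_pow_mem`).

For `L` the field of `m`-th roots of elements of `Γ` (`rootField`), the elements of `Γ_div` whose
`M`-th power lies in `L` form finitely many classes modulo `L`, because `Γ` has finite rank
(`finite_image_divGroup`). So there is a multiple `n` of `m`, independent of `x`, such that over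
the field of `n`-th roots the two terms merge into one. Induction on the number of terms
(`exists_rootField_mul_divGroup`) reduces `x` to a single term over a field of `m`-th roots with
`m` depending on `Γ` and `N` only. That field is generated over `K_Γ`, which contains all roots
of unity, by any choice of `m`-th roots of a basis (`rootField_le_adjoin`).
-/

/-! ### Finite families in abelian groups with a difference represented only once -/

/-- A vector in the rational span of a set of integer vectors becomes, after multiplication by a
positive integer, an integral combination of them. -/
theorem exists_nsmul_mem_closure_of_mem_span {ι : Type*} (S : Set (ι → ℤ)) (w : ι → ℤ)
    (hw : (Int.castRingHom ℚ).toAddMonoidHom.compLeft ι w ∈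
      Submodule.span ℚ ((Int.castRingHom ℚ).toAddMonoidHom.compLeft ι '' S)) :
    ∃ t : ℕ, 0 < t ∧ t • w ∈ AddSubgroup.closure S := by
  set c := (Int.castRingHom ℚ).toAddMonoidHom.compLeft ι with hc
  have hinj : Function.Injective c := fun x y h => funext fun i => by
    have := congrFun h i
    simpa [hc] using this
  have key : ∀ v ∈ Submodule.span ℚ (c '' S),
      ∃ t : ℕ, 0 < t ∧ ∃ u ∈ AddSubgroup.closure S, t • v = c u := by
    intro v hv
    induction hv using Submodule.span_induction with
    | mem v h =>
      obtain ⟨u, hu, rfl⟩ := h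
      exact ⟨1, one_pos, u, AddSubgroup.subset_closure hu, one_nsmul _⟩
    | zero => exact ⟨1, one_pos, 0, AddSubgroup.zero_mem _, by simp⟩
    | add x y _ _ hx hy =>
      obtain ⟨a, ha, u, hu, hau⟩ := hx
      obtain ⟨b, hb, v, hv, hbv⟩ := hy
      refine ⟨a * b, Nat.mul_pos ha hb, b • u + a • v,
        add_mem (nsmul_mem hu b) (nsmul_mem hv a), ?_⟩
      rw [map_add, map_nsmul, map_nsmul, ← hau, ← hbv, smul_add, mul_comm, mul_smul,
        mul_comm b a, mul_smul]
    | smul q x _ hx =>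
      obtain ⟨a, ha, u, hu, hau⟩ := hx
      refine ⟨q.den * a, Nat.mul_pos q.pos ha, q.num • u, zsmul_mem hu _, ?_⟩
      rw [map_zsmul, ← hau]
      ext i
      have := Rat.den_mul_eq_num q
      simp only [Pi.smul_apply, nsmul_eq_mul, smul_eq_mul, zsmul_eq_mul, Nat.cast_mul,
        Pi.mul_apply, Pi.natCast_apply]
      linear_combination (a * x i) * this
  obtain ⟨t, ht, u, hu, h⟩ := key _ hw
  refine ⟨t, ht, ?_⟩
  rw [← map_nsmul] at h
  rwa [hinj h]

/-- A family of `n ≥ 2` elements of an abelian group whose `M`-th powers are pairwise distinct has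
a quotient `s i / s j` that no other pair of indices represents. The exponent `M` depends only on
`n`: the relations `s i / s j = s k / s l` holding in the group are one of finitely many sets, and
for each such set the universal group they define is, up to torsion, a lattice in a rational
vector space, where unique differences exist. -/
theorem exists_unique_div (n : ℕ) (hn : 2 ≤ n) :
    ∃ M : ℕ, 0 < M ∧ ∀ {D : Type} [CommGroup D] (s : Fin n → D),
      (∀ i j, i ≠ j → s i ^ M ≠ s j ^ M) →
      ∃ i j, i ≠ j ∧ ∀ k l, s i / s j = s k / s l → k = i ∧ l = j := by
  classical
  let c := (Int.castRingHom ℚ).toAddMonoidHom.compLeft (Fin n)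
  let e : Fin n → Fin n → ℤ := fun i => Pi.single i 1
  let rel : Fin n × Fin n × Fin n × Fin n → (Fin n → ℤ) :=
    fun q => e q.1 - e q.2.1 - (e q.2.2.1 - e q.2.2.2)
  have ht : ∀ (R : Set (Fin n × Fin n × Fin n × Fin n)) (i j : Fin n), ∃ t : ℕ, 0 < t ∧
      (c (e i - e j) ∈ Submodule.span ℚ (c '' (rel '' R)) →
        t • (e i - e j) ∈ AddSubgroup.closure (rel '' R)) := by
    intro R i j
    by_cases h : c (e i - e j) ∈ Submodule.span ℚ (c '' (rel '' R))
    · obtain ⟨t, h0, h1⟩ := exists_nsmul_mem_closure_of_mem_span _ _ h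
      exact ⟨t, h0, fun _ => h1⟩
    · exact ⟨1, one_pos, fun h' => absurd h' h⟩
  choose t ht0 ht using ht
  refine ⟨∏ R, ∏ i, ∏ j, t R i j, Finset.prod_pos fun R _ => Finset.prod_pos fun i _ =>
    Finset.prod_pos fun j _ => ht0 R i j, ?_⟩
  intro D _ s hs
  -- `R` is the set of relations holding in `D`. The vectors `p i` satisfy them in the rational
  -- space `ℚ ^ n / W`; they are distinct, since `p i = p j` makes `s i / s j` torsion.
  let R : Set (Fin n × Fin n × Fin n × Fin n) := {q | s q.1 / s q.2.1 = s q.2.2.1 / s q.2.2.2}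
  let W := Submodule.span ℚ (c '' (rel '' R))
  let p : Fin n → (Fin n → ℚ) ⧸ W := fun i => W.mkQ (c (e i))
  let f : (Fin n → ℤ) →+ Additive D :=
    (Fintype.linearCombination ℤ (fun i => Additive.ofMul (s i))).toAddMonoidHom
  have hf : ∀ i, f (e i) = Additive.ofMul (s i) := fun i => by
    simp [f, e, Fintype.linearCombination_apply_single]
  have hfR : AddSubgroup.closure (rel '' R) ≤ f.ker := by
    rw [AddSubgroup.closure_le]
    rintro _ ⟨q, hq, rfl⟩
    change f (rel q) = 0
    simp only [rel, map_sub, hf]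
    exact sub_eq_zero.2 hq
  have hp : Function.Injective p := by
    intro i j hij
    by_contra hne
    have h1 : c (e i - e j) ∈ W := by
      rw [map_sub]
      exact (Submodule.Quotient.eq W).1 hij
    have h2 : f (t R i j • (e i - e j)) = 0 := hfR (ht R i j h1)
    rw [map_nsmul, map_sub, hf, hf, smul_sub, sub_eq_zero, ← ofMul_pow, ← ofMul_pow] at h2
    have h3 : s i ^ t R i j = s j ^ t R i j := h2
    have h4 : t R i j ∣ ∏ R, ∏ i, ∏ j, t R i j :=
      (Finset.dvd_prod_of_mem (fun j => t R i j) (Finset.mem_univ j)).trans <|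
        (Finset.dvd_prod_of_mem (fun i => ∏ j, t R i j) (Finset.mem_univ i)).trans <|
          Finset.dvd_prod_of_mem (fun R => ∏ i, ∏ j, t R i j) (Finset.mem_univ R)
    obtain ⟨d, hd⟩ := h4
    exact hs i j hne (by rw [hd, pow_mul, pow_mul, h3])
  have hne : (Finset.univ.image p).Nonempty := ⟨p ⟨0, by omega⟩, by simp⟩
  have hne' : (Finset.univ.image fun i => -p i).Nonempty := ⟨-p ⟨0, by omega⟩, by simp⟩
  obtain ⟨a, ha, b, hb, hu⟩ := UniqueSums.uniqueAdd_of_nonempty hne hne'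
  simp only [Finset.mem_image, Finset.mem_univ, true_and] at ha hb
  obtain ⟨i, rfl⟩ := ha
  obtain ⟨j, rfl⟩ := hb
  have hu' : ∀ k l, p i - p j = p k - p l → k = i ∧ l = j := by
    intro k l h
    have := hu (a := p k) (b := -p l) (by simp) (by simp) (by rw [← sub_eq_add_neg, ← h]; abel)
    exact ⟨hp this.1, hp (neg_injective this.2)⟩
  refine ⟨i, j, ?_, fun k l h => hu' k l ?_⟩
  -- The zero difference is represented `n ≥ 2` times.
  · rintro rfl
    have h0 := (hu' ⟨0, by omega⟩ ⟨0, by omega⟩ (by simp)).1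
    have h1 := (hu' ⟨1, by omega⟩ ⟨1, by omega⟩ (by simp)).1
    simpa using h0.trans h1.symm
  · have : c (rel (i, j, k, l)) ∈ W := Submodule.subset_span ⟨_, ⟨_, h, rfl⟩, rfl⟩
    simp only [p, ← map_sub]
    rw [Submodule.mkQ_apply, Submodule.mkQ_apply, Submodule.Quotient.eq, ← map_sub]
    exact this

/-! ### Torsion in abelian groups of bounded rank -/

/-- In a torsion abelian group with `s` generators, at most `k ^ s` elements are killed by `k`:
the group is finite, so the kernel of the `k`-th power map is as large as its cokernel. -/
theorem ncard_le_of_pow_eq_one {Q : Type*} [CommGroup Q] {s k : ℕ} (hk : 0 < k) (g : Fin s → Q)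
    (hg : ∀ i, IsOfFinOrder (g i)) (X : Set Q)
    (hX : X ⊆ Subgroup.closure (Set.range g)) (hXk : ∀ x ∈ X, x ^ k = 1) :
    X.ncard ≤ k ^ s := by
  set P := Subgroup.closure (Set.range g) with hP
  have hfg : Group.FG P := (Group.fg_iff_subgroup_fg P).2
    ((Subgroup.fg_iff P).2 ⟨_, rfl, Set.finite_range g⟩)
  have htors : IsMulTorsion P := by
    have h : P ≤ CommGroup.torsion Q := by
      rw [hP, Subgroup.closure_le]
      rintro _ ⟨i, rfl⟩
      exact hg i
    exact fun x => Submonoid.isOfFinOrder_coe.1 (h x.2)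
  have hfin : Finite P := CommGroup.finite_of_fg_isMulTorsion P htors
  let φ : P →* P := powMonoidHom k
  have h1 : Nat.card φ.ker = Nat.card (P ⧸ φ.range) := by
    have h2 := φ.ker.card_mul_index
    have h3 := φ.range.card_mul_index
    rw [Subgroup.index_ker] at h2
    rw [← h2, mul_comm] at h3
    exact (Nat.eq_of_mul_eq_mul_right Nat.card_pos h3).symm
  let y : Fin s → P := fun i => ⟨g i, Subgroup.subset_closure ⟨i, rfl⟩⟩
  have hsurj : Function.Surjective
      (fun r : Fin s → Fin k => (QuotientGroup.mk (∏ i, y i ^ (r i : ℕ)) : P ⧸ φ.range)) := by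
    intro z
    obtain ⟨⟨z, hz⟩, rfl⟩ := QuotientGroup.mk_surjective z
    obtain ⟨a, rfl⟩ := Subgroup.mem_closure_range_iff_of_fintype.1 hz
    have hk' : (0 : ℤ) < k := by exact_mod_cast hk
    refine ⟨fun i => ⟨(a i % k).toNat, ?_⟩, ?_⟩
    · have := Int.emod_nonneg (a i) hk'.ne'
      have := Int.emod_lt_of_pos (a i) hk'
      omega
    · rw [QuotientGroup.eq]
      refine ⟨∏ i, y i ^ (a i / k), ?_⟩
      rw [eq_inv_mul_iff_mul_eq]
      ext
      simp only [φ, y, powMonoidHom_apply, Subgroup.coe_mul, Subgroup.coe_pow,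
        Subgroup.val_finsetProd, Subgroup.coe_zpow]
      rw [← Finset.prod_pow, ← Finset.prod_mul_distrib]
      refine Finset.prod_congr rfl fun i _ => ?_
      rw [← zpow_natCast, ← zpow_natCast, Int.toNat_of_nonneg (Int.emod_nonneg _ hk'.ne'),
        ← zpow_mul, ← zpow_add, mul_comm, Int.emod_add_mul_ediv]
  have h4 : Nat.card φ.ker ≤ k ^ s := by
    rw [h1]
    simpa using Nat.card_le_card_of_surjective _ hsurj
  refine le_trans ?_ h4
  rw [← Nat.card_coe_set_eq]
  refine Nat.card_le_card_of_injective
    (fun x : X => (⟨⟨x, hX x.2⟩, Subtype.ext (hXk x x.2)⟩ : φ.ker)) fun x x' h => ?_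
  simpa [Subtype.ext_iff] using h

/-- A set of elements killed by `k` is finite if each of its finite subsets lies in a torsion
subgroup with `s` generators, for a fixed `s`. -/
theorem finite_of_pow_eq_one {Q : Type*} [CommGroup Q] {s k : ℕ} (hk : 0 < k) (X : Set Q)
    (hXk : ∀ x ∈ X, x ^ k = 1)
    (hX : ∀ T : Finset Q, (T : Set Q) ⊆ X → ∃ g : Fin s → Q, (∀ i, IsOfFinOrder (g i)) ∧
      (T : Set Q) ⊆ Subgroup.closure (Set.range g)) :
    X.Finite := by
  by_contra hinf
  obtain ⟨T, hT, hcard⟩ := Set.Infinite.exists_subset_card_eq hinf (k ^ s + 1)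
  obtain ⟨g, hg, hTg⟩ := hX T hT
  have := ncard_le_of_pow_eq_one hk g hg T hTg fun x hx => hXk x (hT hx)
  rw [Set.ncard_coe_finset] at this
  omega

/-! ### The fields of `m`-th roots -/

theorem isAlgClosed_Qbar : IsAlgClosed Qbar :=
  (algebraicClosure.isAlgClosure ℚ ℂ).isAlgClosed

theorem isGalois_Qbar (K : IntermediateField ℚ Qbar) (L : IntermediateField K Qbar) :
    IsGalois L Qbar :=
  have : IsAlgClosure ℚ Qbar := algebraicClosure.isAlgClosure ℚ ℂ
  have : IsGalois ℚ Qbar := IsAlgClosure.isGalois ℚ _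
  have : IsGalois K Qbar := IsGalois.tower_top_of_isGalois ℚ K Qbar
  IsGalois.tower_top_of_isGalois K L Qbar

theorem exists_unit_pow_eq (u : Qbarˣ) {n : ℕ} (hn : 0 < n) : ∃ v : Qbarˣ, v ^ n = u := by
  have := isAlgClosed_Qbar
  obtain ⟨z, hz⟩ := IsAlgClosed.exists_pow_nat_eq (u : Qbar) hn
  have hz0 : z ≠ 0 := by
    rintro rfl
    rw [zero_pow hn.ne'] at hz
    exact u.ne_zero hz.symm
  exact ⟨Units.mk0 z hz0, Units.ext (by simpa using hz)⟩

namespace GammaDiv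

/-- The field `K_Γ(γ : γ ^ m ∈ Γ)`, generated over `K_Γ` by all `m`-th roots of elements
of `Γ`. -/
noncomputable def rootField (Γ : Subgroup Qbarˣ) (m : ℕ) :
    IntermediateField (baseField Γ) Qbar :=
  IntermediateField.adjoin (baseField Γ) {x : Qbar | ∃ γ : Qbarˣ, γ ^ m ∈ Γ ∧ x = (γ : Qbar)}

variable {Γ : Subgroup Qbarˣ}

theorem rootOfUnity_mem_baseField {ζ : Qbar} {n : ℕ} (hn : 0 < n) (h : ζ ^ n = 1) :
    ζ ∈ baseField Γ :=
  IntermediateField.subset_adjoin _ _ (Or.inl ⟨n, hn, h⟩)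

theorem coe_mem_baseField {γ : Qbarˣ} (h : γ ∈ Γ) : (γ : Qbar) ∈ baseField Γ :=
  IntermediateField.subset_adjoin _ _ (Or.inr ⟨γ, h, rfl⟩)

theorem mem_of_mem_baseField (L : IntermediateField (baseField Γ) Qbar) {x : Qbar}
    (hx : x ∈ baseField Γ) : x ∈ L :=
  L.algebraMap_mem ⟨x, hx⟩

theorem coe_mem_rootField {γ : Qbarˣ} {m : ℕ} (h : γ ^ m ∈ Γ) : (γ : Qbar) ∈ rootField Γ m :=
  IntermediateField.subset_adjoin _ _ ⟨γ, h, rfl⟩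

theorem rootField_mono {m n : ℕ} (h : m ∣ n) : rootField Γ m ≤ rootField Γ n := by
  obtain ⟨d, rfl⟩ := h
  refine IntermediateField.adjoin.mono _ _ _ ?_
  rintro _ ⟨γ, hγ, rfl⟩
  exact ⟨γ, by rw [pow_mul]; exact Γ.pow_mem hγ d, rfl⟩

/-- The group of nonzero elements of an intermediate field. -/
def unitsOf (L : IntermediateField (baseField Γ) Qbar) : Subgroup Qbarˣ where
  carrier := {γ | (γ : Qbar) ∈ L}
  one_mem' := by simp
  mul_mem' := fun ha hb => by
    simp only [Set.mem_ofPred_eq, Units.val_mul] at *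
    exact L.mul_mem ha hb
  inv_mem' := fun ha => by
    simp only [Set.mem_ofPred_eq, Units.val_inv_eq_inv_val] at *
    exact L.inv_mem ha

theorem mem_unitsOf {L : IntermediateField (baseField Γ) Qbar} {γ : Qbarˣ} :
    γ ∈ unitsOf L ↔ (γ : Qbar) ∈ L := Iff.rfl

/-- The elements of `Γ_div` whose `k`-th power lies in the field `L` form finitely many classes
modulo `L`: as `Γ` is finitely generated, the `n`-th roots of `Γ` have, modulo roots of unity, a
number of generators that does not depend on `n`. -/
theorem finite_image_divGroup (hΓ : Γ.FG) (L : IntermediateField (baseField Γ) Qbar) {k : ℕ}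
    (hk : 0 < k) :
    ((QuotientGroup.mk : Qbarˣ → Qbarˣ ⧸ unitsOf L) ''
      {γ | γ ∈ divGroup Γ ∧ γ ^ k ∈ unitsOf L}).Finite := by
  classical
  obtain ⟨S, hS⟩ := hΓ
  let e := S.equivFin.symm
  have hle : Γ ≤ unitsOf L := fun γ hγ => mem_of_mem_baseField L (coe_mem_baseField hγ)
  have hgen : Subgroup.closure (Set.range fun i => (e i : Qbarˣ)) = Γ := by
    rw [← hS]
    congr 1
    ext x
    simp only [Set.mem_range, Finset.mem_coe]
    exact ⟨fun ⟨i, hi⟩ => hi ▸ (e i).2, fun hx => ⟨e.symm ⟨x, hx⟩, by simp⟩⟩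
  refine finite_of_pow_eq_one (s := S.card) hk _ ?_ ?_
  · rintro _ ⟨γ, ⟨_, hγ⟩, rfl⟩
    exact (QuotientGroup.eq_one_iff (γ ^ k)).2 hγ
  intro T hT
  have hlift : ∀ x : T, ∃ γ : Qbarˣ, (∃ n : ℕ, 0 < n ∧ γ ^ n ∈ Γ) ∧
      (QuotientGroup.mk γ : Qbarˣ ⧸ unitsOf L) = x := fun x => by
    obtain ⟨γ, ⟨hγ, _⟩, h⟩ := hT x.2
    exact ⟨γ, hγ, h⟩
  choose u hu hux using hlift
  choose n hn hun using hu
  have hN : 0 < ∏ x, n x := Finset.prod_pos fun x _ => hn x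
  -- Modulo roots of unity, the roots `r i` of the generators of `Γ` generate all elements whose
  -- power of exponent `∏ x, n x` lies in `Γ`.
  choose r hr using fun i => exists_unit_pow_eq (e i : Qbarˣ) hN
  refine ⟨fun i => QuotientGroup.mk (r i), fun i => ?_, fun x hx => ?_⟩
  · refine isOfFinOrder_iff_pow_eq_one.2 ⟨_, hN, (QuotientGroup.eq_one_iff (r i ^ _)).2 ?_⟩
    rw [hr]
    exact hle (hgen.le (Subgroup.subset_closure ⟨i, rfl⟩))
  · have h1 : u ⟨x, hx⟩ ^ (∏ x, n x) ∈ Γ := by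
      obtain ⟨d, hd⟩ := Finset.dvd_prod_of_mem n (Finset.mem_univ (⟨x, hx⟩ : T))
      rw [hd, pow_mul]
      exact Γ.pow_mem (hun _) d
    replace h1 := hgen.ge h1
    obtain ⟨a, ha⟩ := Subgroup.mem_closure_range_iff_of_fintype.1 h1
    refine Subgroup.mem_closure_range_iff_of_fintype.2 ⟨a, ?_⟩
    have h2 : (u ⟨x, hx⟩ / ∏ i, r i ^ a i) ^ (∏ x, n x) = 1 := by
      rw [div_pow, ha, ← Finset.prod_pow, div_eq_one]
      refine Finset.prod_congr rfl fun i _ => ?_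
      rw [← zpow_natCast, ← zpow_mul, mul_comm, zpow_mul, zpow_natCast, hr]
    have h3 : u ⟨x, hx⟩ / ∏ i, r i ^ a i ∈ unitsOf L :=
      mem_of_mem_baseField L (rootOfUnity_mem_baseField hN
        (by rw [← Units.val_pow_eq_pow_val, h2, Units.val_one]))
    have h4 := hux ⟨x, hx⟩
    simp only at h4
    rw [← h4]
    have h5 := (QuotientGroup.eq_one_iff (N := unitsOf L) _).2 h3
    rw [QuotientGroup.mk_div, div_eq_one] at h5
    rw [h5]
    exact map_prod (QuotientGroup.mk' (unitsOf L)) _ _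

/-- Elements of `Γ_div` whose `k`-th power lies in the field of `m`-th roots all lie in the field
of `n`-th roots, for one `n` depending on `k`, `m` and `Γ` only. -/
theorem exists_rootField_of_pow_mem (hΓ : Γ.FG) {m k : ℕ} (hm : 0 < m) (hk : 0 < k) :
    ∃ n : ℕ, 0 < n ∧ m ∣ n ∧ ∀ γ ∈ divGroup Γ, ((γ ^ k : Qbarˣ) : Qbar) ∈ rootField Γ m →
      (γ : Qbar) ∈ rootField Γ n := by
  classical
  have hfin := finite_image_divGroup hΓ (rootField Γ m) hk
  set X := (QuotientGroup.mk : Qbarˣ → Qbarˣ ⧸ unitsOf (rootField Γ m)) ''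
      {γ | γ ∈ divGroup Γ ∧ γ ^ k ∈ unitsOf (rootField Γ m)} with hX
  let _ : Fintype X := hfin.fintype
  have hlift : ∀ x : X, ∃ γ : Qbarˣ, (∃ n : ℕ, 0 < n ∧ γ ^ n ∈ Γ) ∧
      (QuotientGroup.mk γ : Qbarˣ ⧸ unitsOf (rootField Γ m)) = x := fun x => by
    obtain ⟨γ, ⟨hγ, _⟩, h⟩ := x.2
    exact ⟨γ, hγ, h⟩
  choose u hu hux using hlift
  choose n hn hun using hu
  refine ⟨m * ∏ x, n x, Nat.mul_pos hm (Finset.prod_pos fun x _ => hn x), dvd_mul_right _ _,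
    fun γ hγ hγk => ?_⟩
  let x : X := ⟨QuotientGroup.mk γ, γ, ⟨hγ, hγk⟩, rfl⟩
  have h1 : (u x)⁻¹ * γ ∈ unitsOf (rootField Γ m) := QuotientGroup.eq.1 (hux x)
  have h2 : (u x : Qbar) ∈ rootField Γ (m * ∏ x, n x) :=
    rootField_mono (dvd_mul_of_dvd_right (Finset.dvd_prod_of_mem n (Finset.mem_univ x)) m)
      (coe_mem_rootField (hun x))
  have h3 : γ = u x * ((u x)⁻¹ * γ) := by group
  rw [h3, Units.val_mul]
  exact mul_mem h2 (rootField_mono (dvd_mul_right _ _) h1)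

/-- The `m`-th roots of a basis of the torsion-free part of `Γ` generate the field of all `m`-th
roots of elements of `Γ`. -/
theorem rootField_le_adjoin {b m : ℕ} (hm : 0 < m) {α : Fin b → Qbarˣ}
    (hα : IsTorsionFreeBasis Γ α) {β : Fin b → Qbar} (hβ : ∀ i, β i ^ m = (α i : Qbar)) :
    rootField Γ m ≤ IntermediateField.adjoin (baseField Γ) (Set.range β) := by
  rw [rootField, IntermediateField.adjoin_le_iff]
  rintro _ ⟨γ, hγ, rfl⟩
  have hβ0 : ∀ i, β i ≠ 0 := fun i h => (α i).ne_zero (by rw [← hβ i, h, zero_pow hm.ne'])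
  obtain ⟨ζ, a, ⟨n, hn, hζ⟩, h⟩ := hα.generate _ hγ
  have hz : ∏ i, β i ^ a i ≠ 0 := Finset.prod_ne_zero_iff.2 fun i _ => zpow_ne_zero _ (hβ0 i)
  have h1 : ((γ : Qbar) / ∏ i, β i ^ a i) ^ m = (ζ : Qbar) := by
    have h2 : (∏ i, β i ^ a i) ^ m = ∏ i, (α i : Qbar) ^ a i := by
      rw [← Finset.prod_pow]
      refine Finset.prod_congr rfl fun i _ => ?_
      rw [← hβ, ← zpow_natCast, ← zpow_mul, ← zpow_natCast, ← zpow_mul, mul_comm]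
    have h3 := congrArg (Units.val) h
    push_cast at h3
    rw [div_pow, div_eq_iff (pow_ne_zero _ hz), h2, h3]
  have h4 : ((γ : Qbar) / ∏ i, β i ^ a i) ^ (m * n) = 1 := by
    rw [pow_mul, h1, ← Units.val_pow_eq_pow_val, hζ, Units.val_one]
  have h5 : (γ : Qbar) = (γ : Qbar) / (∏ i, β i ^ a i) * ∏ i, β i ^ a i :=
    (div_mul_cancel₀ _ hz).symm
  rw [h5]
  exact mul_mem (mem_of_mem_baseField _ (rootOfUnity_mem_baseField (Nat.mul_pos hm hn) h4))
    (prod_mem fun i _ => zpow_mem (IntermediateField.subset_adjoin _ _ (Set.mem_range_self i)) _)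

end GammaDiv

/-! ### Characters with a combination of constant modulus -/

/-- If `∑ i, A i * χ i` has constant modulus, where the `χ i` are unitary characters, and the
quotient `χ i / χ j` is represented by the pair `(i, j)` only, then `A i = 0` or `A j = 0`: by
linear independence of characters, the coefficient of `χ i / χ j` in the expansion of
`|∑ i, A i * χ i| ^ 2` vanishes. -/
theorem mul_conj_eq_zero_of_norm_sum_const {G : Type*} [Group G] {n : ℕ} (χ : Fin n → (G →* ℂˣ))
    (hχ : ∀ i σ, ‖(χ i σ : ℂ)‖ = 1) (A : Fin n → ℂ) (r : ℝ)
    (hr : ∀ σ, ‖∑ i, A i * (χ i σ : ℂ)‖ = r) {i j : Fin n} (hij : i ≠ j)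
    (huniq : ∀ k l, χ i / χ j = χ k / χ l → k = i ∧ l = j) :
    A i * (starRingEnd ℂ) (A j) = 0 := by
  classical
  let toC : (G →* ℂˣ) → (G →* ℂ) := fun f => (Units.coeHom ℂ).comp f
  have hinj : Function.Injective toC := fun f g h => by
    ext σ
    exact DFunLike.congr_fun h σ
  -- The coefficients of `|∑ i, A i * χ i| ^ 2 - r ^ 2` as a combination of characters.
  let c : (G →* ℂ) →₀ ℂ :=
    (∑ p : Fin n × Fin n, Finsupp.single (toC (χ p.1 / χ p.2))
      (A p.1 * (starRingEnd ℂ) (A p.2))) - Finsupp.single (toC 1) ((r : ℂ) ^ 2)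
  have hc : c = 0 := by
    refine linearIndependent_iff.1 (linearIndependent_monoidHom G ℂ) c ?_
    funext σ
    simp only [c, map_sub, map_sum, Finsupp.linearCombination_single, Pi.sub_apply,
      Finset.sum_apply, Pi.smul_apply, Pi.zero_apply, smul_eq_mul]
    rw [sub_eq_zero, ← hr σ, ← Complex.mul_conj', map_sum, Finset.sum_mul_sum,
      ← Finset.sum_product']
    simp only [toC, MonoidHom.comp_apply, Units.coeHom_apply, MonoidHom.one_apply, Units.val_one,
      mul_one, Finset.univ_product_univ]
    refine Finset.sum_congr rfl fun p _ => ?_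
    have h1 : (starRingEnd ℂ) (χ p.2 σ : ℂ) = (χ p.2 σ : ℂ)⁻¹ :=
      (Complex.inv_eq_conj (hχ p.2 σ)).symm
    rw [map_mul, h1, MonoidHom.div_apply, Units.val_div_eq_div_val]
    ring
  have h := DFunLike.congr_fun hc (toC (χ i / χ j))
  have h1 : χ i / χ j ≠ 1 := fun h1 => hij (huniq i i (by rw [h1]; ext σ; simp)).2
  simp only [c, Finsupp.sub_apply, Finsupp.finsetSum_apply, Finsupp.coe_zero, Pi.zero_apply] at h
  rw [Finsupp.single_eq_of_ne (fun h2 => h1 (hinj h2)), sub_zero,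
    Finset.sum_eq_single (i, j), Finsupp.single_eq_same] at h
  · exact h
  · rintro ⟨k, l⟩ _ hkl
    refine Finsupp.single_eq_of_ne fun h2 => hkl ?_
    obtain ⟨rfl, rfl⟩ := huniq k l (hinj h2)
    rfl
  · simp

/-! ### Kummer characters of the division group -/

namespace GammaDiv

variable {Γ : Subgroup Qbarˣ}

theorem exists_pow_div_eq_one (L : IntermediateField (baseField Γ) Qbar) {γ : Qbarˣ}
    (hγ : γ ∈ divGroup Γ) (σ : Qbar ≃ₐ[L] Qbar) :
    ∃ n : ℕ, 0 < n ∧ (σ (γ : Qbar) / γ) ^ n = 1 := by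
  obtain ⟨n, hn, h⟩ := hγ
  refine ⟨n, hn, ?_⟩
  have h1 : ((γ ^ n : Qbarˣ) : Qbar) ∈ L := mem_of_mem_baseField L (coe_mem_baseField h)
  have h2 : σ ((γ ^ n : Qbarˣ) : Qbar) = ((γ ^ n : Qbarˣ) : Qbar) := σ.commutes ⟨_, h1⟩
  rw [Units.val_pow_eq_pow_val, map_pow] at h2
  rw [div_pow, h2, div_self (pow_ne_zero _ γ.ne_zero)]

/-- The Kummer character `σ ↦ σ γ / γ` of `Gal(Qbar / L)` attached to `γ ∈ Γ_div`, where `L` is a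
field containing `K_Γ`, with values in `ℂˣ`. -/
noncomputable def kummerChar (L : IntermediateField (baseField Γ) Qbar) (γ : divGroup Γ) :
    (Qbar ≃ₐ[L] Qbar) →* ℂˣ where
  toFun σ := Units.map (algebraMap Qbar ℂ).toMonoidHom
    (Units.map (σ : Qbar →* Qbar) (γ : Qbarˣ) / γ)
  map_one' := by
    rw [map_eq_one_iff _ (Units.map_injective (algebraMap Qbar ℂ).injective), div_eq_one]
    ext
    rfl
  map_mul' σ τ := by
    rw [← map_mul]
    congr 1
    obtain ⟨n, hn, h⟩ := exists_pow_div_eq_one L γ.2 τ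
    have h1 : σ (τ ((γ : Qbarˣ) : Qbar) / (γ : Qbarˣ)) = τ ((γ : Qbarˣ) : Qbar) / (γ : Qbarˣ) :=
      σ.commutes ⟨_, mem_of_mem_baseField L (rootOfUnity_mem_baseField hn h)⟩
    have h2 := (γ : Qbarˣ).ne_zero
    have h3 : σ ((γ : Qbarˣ) : Qbar) ≠ 0 := by simp
    refine Units.ext ?_
    rw [Units.val_mul, Units.val_div_eq_div_val, Units.val_div_eq_div_val,
      Units.val_div_eq_div_val]
    change ((σ (τ ((γ : Qbarˣ) : Qbar)) / (γ : Qbarˣ) : Qbar)) =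
      (σ ((γ : Qbarˣ) : Qbar) / (γ : Qbarˣ)) * (τ ((γ : Qbarˣ) : Qbar) / (γ : Qbarˣ))
    rw [map_div₀] at h1
    rw [← h1]
    field_simp

theorem kummerChar_apply (L : IntermediateField (baseField Γ) Qbar) (γ : divGroup Γ)
    (σ : Qbar ≃ₐ[L] Qbar) :
    (kummerChar L γ σ : ℂ) = ((σ ((γ : Qbarˣ) : Qbar) / (γ : Qbarˣ) : Qbar) : ℂ) :=
  congrArg (algebraMap Qbar ℂ) (Units.val_div_eq_div_val _ _)

theorem norm_kummerChar (L : IntermediateField (baseField Γ) Qbar) (γ : divGroup Γ)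
    (σ : Qbar ≃ₐ[L] Qbar) : ‖(kummerChar L γ σ : ℂ)‖ = 1 := by
  obtain ⟨n, hn, h⟩ := exists_pow_div_eq_one L γ.2 σ
  refine Complex.norm_eq_one_of_pow_eq_one (n := n) ?_ hn.ne'
  rw [kummerChar_apply]
  exact_mod_cast congrArg (fun z : Qbar => (z : ℂ)) h

theorem div_pow_mem_of_kummerChar_pow_eq (L : IntermediateField (baseField Γ) Qbar)
    (γ δ : divGroup Γ) {M : ℕ} (h : kummerChar L γ ^ M = kummerChar L δ ^ M) :
    ((((γ : Qbarˣ) / δ) ^ M : Qbarˣ) : Qbar) ∈ L := by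
  have := isGalois_Qbar _ L
  have key : ∀ σ : Qbar ≃ₐ[L] Qbar, σ ((((γ : Qbarˣ) / δ) ^ M : Qbarˣ) : Qbar) =
      ((((γ : Qbarˣ) / δ) ^ M : Qbarˣ) : Qbar) := by
    intro σ
    have h1 := congrArg (Units.val) (DFunLike.congr_fun h σ)
    simp only [MonoidHom.pow_apply, Units.val_pow_eq_pow_val, kummerChar_apply] at h1
    have h2 : (σ ((γ : Qbarˣ) : Qbar) / (γ : Qbarˣ)) ^ M =
        (σ ((δ : Qbarˣ) : Qbar) / (δ : Qbarˣ)) ^ M := by exact_mod_cast h1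
    have hγ := (γ : Qbarˣ).ne_zero
    have hδ := (δ : Qbarˣ).ne_zero
    have hδ' : σ ((δ : Qbarˣ) : Qbar) ≠ 0 := by simp
    rw [div_pow, div_pow, div_eq_div_iff (pow_ne_zero _ hγ) (pow_ne_zero _ hδ)] at h2
    rw [Units.val_pow_eq_pow_val, Units.val_div_eq_div_val, map_pow, map_div₀, div_pow, div_pow,
      div_eq_div_iff (pow_ne_zero _ hδ') (pow_ne_zero _ hδ), h2, mul_comm]
  obtain ⟨y, hy⟩ := IntermediateField.mem_bot.1 ((InfiniteGalois.mem_bot_iff_fixed _).2 key)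
  rw [← hy]
  exact y.2

end GammaDiv

/-! ### Merging terms -/

namespace GammaDiv

variable {Γ : Subgroup Qbarˣ}

/-- In an expansion of an element of `U(Γ)` with `n ≥ 2` nonzero terms over a field `L ⊇ K_Γ`, two
of the radicals have a quotient whose `M`-th power lies in `L`, where `M` is the exponent attached
to `n` by `exists_unique_div`: otherwise some quotient of their Kummer characters is represented
only once, and the product of two nonzero coefficients vanishes. -/
theorem exists_div_pow_mem {n M : ℕ}
    (hM : ∀ {D : Type} [CommGroup D] (s : Fin n → D),
      (∀ i j, i ≠ j → s i ^ M ≠ s j ^ M) →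
      ∃ i j, i ≠ j ∧ ∀ k l, s i / s j = s k / s l → k = i ∧ l = j)
    (L : IntermediateField (baseField Γ) Qbar) {x : Qbar} (hx : x ∈ concyclicSet Γ)
    (T : Finset Qbarˣ) (hT : T.card = n) (a : Qbarˣ → Qbar)
    (hTΓ : ∀ γ ∈ T, γ ∈ divGroup Γ) (ha : ∀ γ ∈ T, a γ ∈ L) (ha0 : ∀ γ ∈ T, a γ ≠ 0)
    (hxT : x = ∑ γ ∈ T, a γ * (γ : Qbar)) :
    ∃ γ ∈ T, ∃ δ ∈ T, γ ≠ δ ∧ (((γ / δ) ^ M : Qbarˣ) : Qbar) ∈ L := by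
  by_contra! hcon
  let e : Fin n ≃ T := (T.equivFinOfCardEq hT).symm
  let g : Fin n → divGroup Γ := fun i => ⟨e i, hTΓ _ (e i).2⟩
  obtain ⟨i, j, hij, huniq⟩ := hM (fun i => kummerChar L (g i)) fun i j hij h =>
    hcon _ (e i).2 _ (e j).2 (fun h' => hij (e.injective (Subtype.ext h')))
      (div_pow_mem_of_kummerChar_pow_eq L (g i) (g j) h)
  let A : Fin n → Qbar := fun i => a (e i) * ((e i : Qbarˣ) : Qbar)
  have hA0 : ∀ i, (A i : ℂ) ≠ 0 := fun i => by
    have : A i ≠ 0 := mul_ne_zero (ha0 _ (e i).2) (Units.ne_zero _)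
    exact_mod_cast this
  obtain ⟨hx0, r, hr⟩ := hx
  have hnorm : ∀ σ : Qbar ≃ₐ[L] Qbar, ‖∑ i, (A i : ℂ) * (kummerChar L (g i) σ : ℂ)‖ = r := by
    intro σ
    rw [← hr (σ x) ⟨σ.restrictScalars (baseField Γ), rfl⟩]
    have h1 : σ x = ∑ i, A i * (σ ((e i : Qbarˣ) : Qbar) / ((e i : Qbarˣ) : Qbar)) := by
      rw [hxT, map_sum, ← Finset.sum_coe_sort T, ← Equiv.sum_comp e]
      refine Finset.sum_congr rfl fun i _ => ?_
      have h2 : σ (a (e i)) = a (e i) := σ.commutes ⟨_, ha _ (e i).2⟩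
      have h3 := (e i : Qbarˣ).ne_zero
      rw [map_mul, h2]
      simp only [A]
      field_simp
    rw [h1]
    congr 1
    change _ = algebraMap Qbar ℂ _
    rw [map_sum]
    refine Finset.sum_congr rfl fun i _ => ?_
    rw [map_mul, kummerChar_apply]
    rfl
  have h := mul_conj_eq_zero_of_norm_sum_const _ (fun i σ => norm_kummerChar L (g i) σ)
    (fun i => (A i : ℂ)) r hnorm hij huniq
  exact mul_ne_zero (hA0 i) ((map_ne_zero _).2 (hA0 j)) h

/-- Induction on the number of terms: two terms whose radicals have a quotient with bounded power
in the field of `m`-th roots can be merged over the field of `n`-th roots, for a multiple `n` of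
`m` that does not depend on the element. -/
theorem exists_rootField_mul_divGroup (hΓ : Γ.FG) (l : ℕ) : ∀ {m : ℕ}, 0 < m →
    ∃ n : ℕ, 0 < n ∧ m ∣ n ∧ ∀ x ∈ concyclicSet Γ, ∀ (T : Finset Qbarˣ) (a : Qbarˣ → Qbar),
      T.card ≤ l → (∀ γ ∈ T, γ ∈ divGroup Γ) → (∀ γ ∈ T, a γ ∈ rootField Γ m) →
      x = ∑ γ ∈ T, a γ * (γ : Qbar) →
      ∃ y ∈ rootField Γ n, ∃ γ ∈ divGroup Γ, x = y * (γ : Qbar) := by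
  classical
  induction l with
  | zero =>
    intro m hm
    refine ⟨m, hm, dvd_rfl, fun x hx T a hT _ _ h => absurd ?_ hx.1⟩
    rw [h, Finset.card_eq_zero.1 (Nat.le_zero.1 hT), Finset.sum_empty]
  | succ l ih =>
    intro m hm
    rcases Nat.eq_zero_or_pos l with rfl | hl
    · refine ⟨m, hm, dvd_rfl, fun x hx T a hT hTΓ ha h => ?_⟩
      rcases Finset.card_le_one_iff_subset_singleton.1 hT with ⟨γ, hγ⟩
      rcases Finset.subset_singleton_iff.1 hγ with rfl | rfl
      · exact absurd (by simpa using h) hx.1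
      · exact ⟨a γ, ha γ (by simp), γ, hTΓ γ (by simp), by simpa using h⟩
    obtain ⟨M, hM0, hM⟩ := exists_unique_div (l + 1) (by omega)
    obtain ⟨m₁, hm₁, hmm₁, hroot⟩ := exists_rootField_of_pow_mem hΓ hm hM0
    obtain ⟨n, hn, hmn, hrec⟩ := ih hm₁
    refine ⟨n, hn, hmm₁.trans hmn, fun x hx T a hT hTΓ ha h => ?_⟩
    have ha₁ : ∀ γ ∈ T, a γ ∈ rootField Γ m₁ := fun γ hγ => rootField_mono hmm₁ (ha γ hγ)
    rcases Nat.lt_or_ge T.card (l + 1) with hlt | hge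
    · exact hrec x hx T a (by omega) hTΓ ha₁ h
    have hcard : T.card = l + 1 := le_antisymm hT hge
    by_cases h0 : ∃ δ ∈ T, a δ = 0
    · obtain ⟨δ, hδ, hδ0⟩ := h0
      refine hrec x hx (T.erase δ) a (by rw [Finset.card_erase_of_mem hδ]; omega)
        (fun γ hγ => hTΓ γ (Finset.mem_of_mem_erase hγ))
        (fun γ hγ => ha₁ γ (Finset.mem_of_mem_erase hγ)) ?_
      rw [h, ← Finset.add_sum_erase T _ hδ, hδ0, zero_mul, zero_add]
    · push Not at h0
      obtain ⟨γ, hγ, δ, hδ, hne, hpow⟩ :=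
        exists_div_pow_mem hM (rootField Γ m) hx T hcard a hTΓ ha h0 h
      have hq : ((γ / δ : Qbarˣ) : Qbar) ∈ rootField Γ m₁ :=
        hroot _ (Subgroup.div_mem _ (hTΓ γ hγ) (hTΓ δ hδ)) hpow
      -- The term of `γ` is absorbed into that of `δ`.
      have hδ' : δ ∈ T.erase γ := Finset.mem_erase.2 ⟨hne.symm, hδ⟩
      refine hrec x hx (T.erase γ) (Function.update a δ (a δ + a γ * ((γ / δ : Qbarˣ) : Qbar)))
        (by rw [Finset.card_erase_of_mem hγ]; omega)
        (fun ε hε => hTΓ ε (Finset.mem_of_mem_erase hε)) (fun ε hε => ?_) ?_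
      · rcases eq_or_ne ε δ with rfl | hεδ
        · rw [Function.update_self]
          exact add_mem (ha₁ _ hδ) (mul_mem (ha₁ _ hγ) hq)
        · rw [Function.update_of_ne hεδ]
          exact ha₁ ε (Finset.mem_of_mem_erase hε)
      · rw [h, ← Finset.add_sum_erase T _ hγ, ← Finset.add_sum_erase (T.erase γ) _ hδ',
          ← Finset.add_sum_erase (T.erase γ) _ hδ', Function.update_self, add_mul, mul_assoc,
          ← Units.val_mul, div_mul_cancel, ← add_assoc, add_comm (a γ * (γ : Qbar))]
        congr 1
        refine Finset.sum_congr rfl fun ε hε => ?_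
        rw [Function.update_of_ne (Finset.ne_of_mem_erase hε)]

theorem exists_isSumOfLength {N : ℕ} {x : Qbar} (hx : x ∈ boundedLength Γ N) :
    ∃ l ≤ N, IsSumOfLength Γ l x := by
  by_contra! hcon
  have h : ((N + 1 : ℕ) : ℕ∞) ≤ length Γ x := by
    refine le_iInf₂ fun l hl => ?_
    have : N + 1 ≤ l := by
      by_contra! hlt
      exact hcon l (by omega) hl.2
    exact_mod_cast this
  have := h.trans hx.2
  have : N + 1 ≤ N := by exact_mod_cast this
  omega

end GammaDiv

/-! ### Reduction to a single term -/

/-- Here `β i` is any chosen `m`-th root of `α i`, so `Set.range β` is `𝓕^{1/m}` for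
`𝓕 = {α_1, …, α_b}`. -/
theorem mainTheorem6 (Γ : Subgroup Qbarˣ) (hΓ : Γ.FG) (N : ℕ) (hN : 1 ≤ N) :
    ∃ m : ℕ, 0 < m ∧
      ∀ (b : ℕ) (α : Fin b → Qbarˣ), GammaDiv.IsTorsionFreeBasis Γ α →
        ∀ β : Fin b → Qbar, (∀ i, β i ^ m = (α i : Qbar)) →
          GammaDiv.boundedLength Γ N ∩ GammaDiv.concyclicSet Γ ⊆
            GammaDiv.mulDiv Γ
              {x : Qbar | x ∈ IntermediateField.adjoin (GammaDiv.baseField Γ) (Set.range β) ∧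
                x ≠ 0} := by
  classical
  obtain ⟨m, hm, -, h⟩ := GammaDiv.exists_rootField_mul_divGroup hΓ N one_pos
  refine ⟨m, hm, fun b α hα β hβ x ⟨hxN, hxU⟩ => ?_⟩
  obtain ⟨l, hl, a, γ, ha, hγ, hx⟩ := GammaDiv.exists_isSumOfLength hxN
  -- Terms with the same radical are collected first.
  obtain ⟨y, hy, δ, hδ, hxy⟩ := h x hxU (Finset.univ.image γ)
    (fun δ => ∑ j with γ j = δ, a j)
    (Finset.card_image_le.trans (by simpa using hl))
    (fun δ hδ => by
      obtain ⟨j, -, rfl⟩ := Finset.mem_image.1 hδ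
      exact hγ j)
    (fun δ _ => sum_mem fun j _ => GammaDiv.mem_of_mem_baseField _ (ha j))
    (by
      rw [hx, ← Finset.sum_fiberwise_of_maps_to (g := γ)
        (fun j _ => Finset.mem_image_of_mem γ (Finset.mem_univ j))]
      refine Finset.sum_congr rfl fun δ _ => ?_
      rw [Finset.sum_mul]
      refine Finset.sum_congr rfl fun j hj => ?_
      rw [(Finset.mem_filter.1 hj).2])
  refine ⟨y, ⟨GammaDiv.rootField_le_adjoin hm hα hβ hy, ?_⟩, δ, hδ, hxy⟩
  rintro rfl
  exact hxU.1 (by rw [hxy, zero_mul])
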